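/- Let $N\ge 1$, let $\Omega\subset\mathbb{R}^N$ be a bounded, connected, nonempty open set with Lipschitz boundary (near each boundary point, after a rotation, $\Omega$ is the set of points lying strictly above the graph of a Lipschitz function), and let $f\in L^1(\Omega)$ with $f>0$ a.e. in $\Omega$. Then there exists a constant $C>0$ (depending only on $N$, $\Omega$ and $f$) such that for every real-valued $u\in H^1(\Omega)$, $$\|u\|_{H^1(\Omega)}\le C\left(\|\nabla u\|_{L^2(\Omega)}+\|u\|_{L^2(\Omega,f)}\right),\qquad \|u\|_{L^2(\Omega,f)}=\left(\int_\Omega f\,u^2\,dx\right)^{1/2},$$ where $\nabla u$ is the weak gradient, $\|u\|_{H^1(\Omega)}=\left(\|u\|_{L^2(\Omega)}^2+\|\nabla u\|_{L^2(\Omega)}^2\right)^{1/2}$, and $\|u\|_{L^2(\Omega,f)}\in[0,+\infty]$ (if $f u^2$ is not integrable, the right-hand side is $+\infty$ and the inequality holds trivially). -/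

import Mathlib

open MeasureTheory Metric Set
open scoped ENNReal NNReal ContDiff

noncomputable section

/-- `Ω ⊆ ℝ^N` is an open set with Lipschitz boundary: near each boundary point `p` there are a unit
vector `ν` (the vertical direction) and a Lipschitz function `φ` on the hyperplane `ν^⊥` such that
`Ω` coincides in a ball around `p` with the set of the points lying strictly above the graph
of `φ`. -/
def IsLipschitzOpen {N : ℕ} (Ω : Set (EuclideanSpace ℝ (Fin N))) : Prop :=
  IsOpen Ω ∧
    ∀ p ∈ frontier Ω, ∃ r : ℝ, 0 < r ∧ ∃ ν : EuclideanSpace ℝ (Fin N), ‖ν‖ = 1 ∧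
      ∃ (L : ℝ≥0) (φ : (Submodule.span ℝ {ν})ᗮ → ℝ), LipschitzWith L φ ∧
        ∀ y ∈ ball p r,
          y ∈ Ω ↔ φ ((Submodule.span ℝ {ν})ᗮ.orthogonalProjectionOnto y) < inner ℝ ν y

/-- `g` is a weak (distributional) gradient of `u` in `Ω`: both are locally integrable in `Ω` and
`∫_Ω u ∂ᵢη = - ∫_Ω gᵢ η` for every `i` and every `η ∈ C_c^∞(Ω)`. -/
structure HasWeakGradient {N : ℕ} (Ω : Set (EuclideanSpace ℝ (Fin N)))
    (u : EuclideanSpace ℝ (Fin N) → ℝ)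
    (g : EuclideanSpace ℝ (Fin N) → EuclideanSpace ℝ (Fin N)) : Prop where
  locallyIntegrableOn : LocallyIntegrableOn u Ω volume
  locallyIntegrableOn_grad : LocallyIntegrableOn g Ω volume
  integral_eq : ∀ η : EuclideanSpace ℝ (Fin N) → ℝ, ContDiff ℝ ∞ η → HasCompactSupport η →
    tsupport η ⊆ Ω → ∀ i : Fin N,
      ∫ x in Ω, u x * fderiv ℝ η x (EuclideanSpace.single i 1) = - ∫ x in Ω, g x i * η x

/-- `u ∈ H¹(Ω)`: `u ∈ L²(Ω)` and `u` has a weak gradient in `L²(Ω)`. -/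
def MemH1 {N : ℕ} (Ω : Set (EuclideanSpace ℝ (Fin N))) (u : EuclideanSpace ℝ (Fin N) → ℝ) : Prop :=
  MemLp u 2 (volume.restrict Ω) ∧ ∃ g : EuclideanSpace ℝ (Fin N) → EuclideanSpace ℝ (Fin N),
    HasWeakGradient Ω u g ∧ MemLp g 2 (volume.restrict Ω)

/-- The norm `(‖u‖²_{L²(Ω)} + ‖∇u‖²_{L²(Ω)})^{1/2}` of a function `u ∈ H¹(Ω)` with weak gradient
`g = ∇u` (which is unique up to a null subset of `Ω`). -/
def h1Norm {N : ℕ} (Ω : Set (EuclideanSpace ℝ (Fin N))) (u : EuclideanSpace ℝ (Fin N) → ℝ)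
    (g : EuclideanSpace ℝ (Fin N) → EuclideanSpace ℝ (Fin N)) : ℝ≥0∞ :=
  (eLpNorm u 2 (volume.restrict Ω) ^ 2 + eLpNorm g 2 (volume.restrict Ω) ^ 2) ^ (1 / 2 : ℝ)

/-- The weighted norm `‖u‖_{L²(Ω,f)} = (∫_Ω f u² dx)^{1/2} ∈ [0,∞]`, for a weight `f ≥ 0`. It is a
Lebesgue integral with values in `[0,∞]`: `f u²` need not be integrable for `u ∈ H¹(Ω)`. -/
def weightedL2Norm {N : ℕ} (Ω : Set (EuclideanSpace ℝ (Fin N)))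
    (f u : EuclideanSpace ℝ (Fin N) → ℝ) : ℝ≥0∞ :=
  (∫⁻ x in Ω, ENNReal.ofReal (f x * u x ^ 2)) ^ (1 / 2 : ℝ)

end

section WeightedPoincare

open Filter Topology Convolution

theorem sq_lintegral_le_of_measure_univ_le_one {α : Type*} [MeasurableSpace α] {μ : Measure α}
    (hμ : μ univ ≤ 1) {h : α → ℝ≥0∞} (hh : AEMeasurable h μ) :
    (∫⁻ x, h x ∂μ) ^ 2 ≤ ∫⁻ x, h x ^ 2 ∂μ := by
  have key := ENNReal.lintegral_mul_le_Lp_mul_Lq μ Real.HolderConjugate.two_two hh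
    (aemeasurable_const (b := (1 : ℝ≥0∞)))
  simp only [Pi.mul_apply, mul_one, lintegral_const, ENNReal.rpow_two, one_pow,
    one_mul] at key
  calc (∫⁻ x, h x ∂μ) ^ 2
      ≤ ((∫⁻ x, h x ^ 2 ∂μ) ^ (1 / 2 : ℝ) * 1) ^ 2 := by
        gcongr
        refine key.trans ?_
        gcongr
        exact ENNReal.rpow_le_one hμ (by norm_num)
    _ = ∫⁻ x, h x ^ 2 ∂μ := by
        rw [mul_one, ← ENNReal.rpow_two, ← ENNReal.rpow_mul]
        norm_num

section Segment

variable {E : Type*} [NormedAddCommGroup E] [NormedSpace ℝ E]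

theorem enorm_sub_sq_le_lintegral_fderiv {v : E → ℝ} (hv : ContDiff ℝ 1 v) (a b : E) :
    ‖v a - v b‖ₑ ^ 2 ≤
      ‖b - a‖ₑ ^ 2 * ∫⁻ t in Icc (0 : ℝ) 1, ‖fderiv ℝ v (a + t • (b - a))‖ₑ ^ 2 := by
  have hc : Continuous fun t : ℝ => fderiv ℝ v (a + t • (b - a)) :=
    (hv.continuous_fderiv one_ne_zero).comp (by fun_prop)
  have hd : ∀ t : ℝ, HasDerivAt (fun t : ℝ => v (a + t • (b - a)))
      (fderiv ℝ v (a + t • (b - a)) (b - a)) t := by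
    intro t
    have h1 : HasDerivAt (fun t : ℝ => a + t • (b - a)) (b - a) t := by
      simpa using ((hasDerivAt_id t).smul_const (b - a)).const_add a
    exact ((hv.differentiable one_ne_zero _).hasFDerivAt).comp_hasDerivAt t h1
  have hft : v b - v a = ∫ t in (0 : ℝ)..1, fderiv ℝ v (a + t • (b - a)) (b - a) := by
    rw [intervalIntegral.integral_eq_sub_of_hasDerivAt (fun t _ => hd t)
      ((hc.clm_apply continuous_const).intervalIntegrable _ _)]
    simp
  have hm : AEMeasurable (fun t : ℝ => ‖fderiv ℝ v (a + t • (b - a))‖ₑ)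
      (volume.restrict (Icc (0 : ℝ) 1)) := hc.enorm.measurable.aemeasurable
  have h1 : ‖v a - v b‖ₑ ≤ ‖b - a‖ₑ * ∫⁻ t in Icc (0 : ℝ) 1, ‖fderiv ℝ v (a + t • (b - a))‖ₑ := by
    rw [← enorm_neg, neg_sub, hft, intervalIntegral.integral_of_le zero_le_one,
      ← integral_Icc_eq_integral_Ioc]
    refine (enorm_integral_le_lintegral_enorm _).trans ?_
    rw [← lintegral_const_mul'' _ hm]
    refine lintegral_mono fun t => ?_
    rw [mul_comm]
    exact ContinuousLinearMap.le_opENorm _ _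
  calc ‖v a - v b‖ₑ ^ 2
      ≤ (‖b - a‖ₑ * ∫⁻ t in Icc (0 : ℝ) 1, ‖fderiv ℝ v (a + t • (b - a))‖ₑ) ^ 2 := by gcongr
    _ ≤ _ := by
        rw [mul_pow]
        gcongr
        exact sq_lintegral_le_of_measure_univ_le_one (by simp) hm

variable [FiniteDimensional ℝ E] [MeasurableSpace E] [BorelSpace E]
  (μ : Measure E) [μ.IsAddHaarMeasure]

theorem lintegral_comp_smul_add {G : E → ℝ≥0∞} (hG : Measurable G) {s : ℝ} (hs : s ≠ 0) (w : E) :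
    ∫⁻ x, G (s • x + w) ∂μ =
      ENNReal.ofReal |(s ^ Module.finrank ℝ E)⁻¹| * ∫⁻ x, G x ∂μ := by
  have h := lintegral_map (μ := μ) (f := fun x => G (x + w)) (g := fun x => s • x)
    (hG.comp (measurable_add_const w)) (measurable_const_smul s)
  rw [← h, Measure.map_addHaar_smul μ hs, lintegral_smul_measure, lintegral_add_right_eq_self,
    smul_eq_mul]

theorem lintegral_comp_smul_add_le {G : E → ℝ≥0∞} (hG : Measurable G) {s : ℝ} (hs : 1 / 2 ≤ s)
    (w : E) :
    ∫⁻ x, G (s • x + w) ∂μ ≤ 2 ^ Module.finrank ℝ E * ∫⁻ x, G x ∂μ := by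
  have hs0 : 0 < s := by linarith
  rw [lintegral_comp_smul_add μ hG hs0.ne']
  gcongr
  rw [abs_of_pos (by positivity), ← inv_pow, ENNReal.ofReal_pow (by positivity)]
  gcongr
  rw [show (2 : ℝ≥0∞) = ENNReal.ofReal 2 by simp]
  apply ENNReal.ofReal_le_ofReal
  rw [inv_le_comm₀ hs0 two_pos]
  linarith

/-- The average of `G` over the segments that join two sets is controlled by the integral
of `G`. -/
theorem lintegral_prod_segment_le {G : E → ℝ≥0∞} (hG : Measurable G) (A B : Set E) :
    ∫⁻ p, (∫⁻ t in Icc (0 : ℝ) 1, G (p.1 + t • (p.2 - p.1))) ∂((μ.restrict A).prod (μ.restrict B)) ≤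
      (μ A + μ B) * (2 ^ Module.finrank ℝ E * ∫⁻ x, G x ∂μ) := by
  set K : ℝ≥0∞ := 2 ^ Module.finrank ℝ E * ∫⁻ x, G x ∂μ with hK
  have hm : Measurable fun q : (E × E) × ℝ => G (q.1.1 + q.2 • (q.1.2 - q.1.1)) :=
    hG.comp (by fun_prop)
  rw [lintegral_lintegral_swap hm.aemeasurable]
  have hmt : ∀ t : ℝ, Measurable fun p : E × E => G (p.1 + t • (p.2 - p.1)) :=
    fun t => hG.comp (by fun_prop)
  have hbound : ∀ t : ℝ, ∫⁻ p, G (p.1 + t • (p.2 - p.1)) ∂((μ.restrict A).prod (μ.restrict B)) ≤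
      (μ A + μ B) * K := by
    intro t
    rcases le_total (1 / 2) t with ht | ht
    · rw [lintegral_prod _ (hmt t).aemeasurable]
      calc ∫⁻ a in A, ∫⁻ b in B, G (a + t • (b - a)) ∂μ ∂μ ≤ ∫⁻ a in A, K ∂μ := by
            refine lintegral_mono fun a => (setLIntegral_le_lintegral _ _).trans ?_
            have e : ∀ b : E, a + t • (b - a) = t • b + (a - t • a) := fun b => by module
            simp_rw [e]
            exact lintegral_comp_smul_add_le μ hG ht _
        _ = μ A * K := by simp [mul_comm]
        _ ≤ _ := by gcongr; exact le_self_add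
    · rw [lintegral_prod_symm _ (hmt t).aemeasurable]
      calc ∫⁻ b in B, ∫⁻ a in A, G (a + t • (b - a)) ∂μ ∂μ ≤ ∫⁻ b in B, K ∂μ := by
            refine lintegral_mono fun b => (setLIntegral_le_lintegral _ _).trans ?_
            have e : ∀ a : E, a + t • (b - a) = (1 - t) • a + t • b := fun a => by module
            simp_rw [e]
            exact lintegral_comp_smul_add_le μ hG (by linarith) _
        _ = μ B * K := by simp [mul_comm]
        _ ≤ _ := by gcongr; exact le_add_self
  calc _ ≤ ∫⁻ t in Icc (0 : ℝ) 1, (μ A + μ B) * K := lintegral_mono fun t => hbound t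
    _ = _ := by simp

end Segment

section Mollify

variable {N : ℕ} {Ω : Set (EuclideanSpace ℝ (Fin N))} {u : EuclideanSpace ℝ (Fin N) → ℝ}
  {g : EuclideanSpace ℝ (Fin N) → EuclideanSpace ℝ (Fin N)}

/-- The derivative of the mollification of a function with a weak gradient is the mollification
of the weak gradient. -/
theorem HasWeakGradient.fderiv_convolution (hug : HasWeakGradient Ω u g) (hΩ : MeasurableSet Ω)
    (hu : IntegrableOn u Ω) (hg : IntegrableOn g Ω) {ρ : EuclideanSpace ℝ (Fin N) → ℝ}
    (hρ : ContDiff ℝ ∞ ρ) (hρc : HasCompactSupport ρ) {x : EuclideanSpace ℝ (Fin N)}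
    (hx : tsupport (fun y => ρ (x - y)) ⊆ Ω) :
    fderiv ℝ (ρ ⋆[ContinuousLinearMap.lsmul ℝ ℝ, volume] Ω.indicator u) x =
      innerSL ℝ (∫ y in Ω, ρ (x - y) • g y) := by
  have hui : Integrable (Ω.indicator u) := (integrable_indicator_iff hΩ).2 hu
  have hρ1 : ContDiff ℝ 1 ρ := hρ.of_le (by exact_mod_cast le_top)
  have hη : ContDiff ℝ ∞ fun y => ρ (x - y) := hρ.comp (contDiff_const.sub contDiff_id)
  have hηc : HasCompactSupport fun y => ρ (x - y) :=
    hρc.comp_homeomorph (Homeomorph.subLeft x)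
  have hηg : IntegrableOn (fun y => ρ (x - y) • g y) Ω := by
    obtain ⟨C, hC⟩ := hη.continuous.bounded_above_of_compact_support hηc
    exact hg.bdd_smul C hη.continuous.aestronglyMeasurable (ae_of_all _ hC)
  have hfd : ∀ v, fderiv ℝ (ρ ⋆[ContinuousLinearMap.lsmul ℝ ℝ, volume] Ω.indicator u) x v =
      - ∫ y in Ω, u y * fderiv ℝ (fun y => ρ (x - y)) y v := by
    intro v
    have hex := (hρc.fderiv ℝ).convolutionExists_left
      ((ContinuousLinearMap.lsmul ℝ ℝ : ℝ →L[ℝ] ℝ →L[ℝ] ℝ).precompL (EuclideanSpace ℝ (Fin N)))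
      (hρ1.continuous_fderiv one_ne_zero) hui.locallyIntegrable x
    rw [(hρc.hasFDerivAt_convolution_left (ContinuousLinearMap.lsmul ℝ ℝ) hρ1
      hui.locallyIntegrable x).fderiv, convolution_eq_swap, ContinuousLinearMap.integral_apply
      ((convolutionExistsAt_iff_integrable_swap).1 hex), ← integral_neg,
      ← integral_indicator hΩ]
    refine integral_congr_ae (ae_of_all _ fun y => ?_)
    have hd : fderiv ℝ (fun y => ρ (x - y)) y = - fderiv ℝ ρ (x - y) := by
      have h1 : HasFDerivAt (fun y => x - y)
          (-ContinuousLinearMap.id ℝ (EuclideanSpace ℝ (Fin N))) y :=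
        (hasFDerivAt_id y).const_sub x
      have := ((hρ1.differentiable one_ne_zero (x - y)).hasFDerivAt.comp y h1).fderiv
      rw [Function.comp_def] at this
      rw [this]
      ext
      simp
    by_cases hy : y ∈ Ω
    · simp [hy, hd, mul_comm]
    · simp [hy]
  have hL : (fderiv ℝ (ρ ⋆[ContinuousLinearMap.lsmul ℝ ℝ, volume] Ω.indicator u) x).toLinearMap =
      (innerSL ℝ (∫ y in Ω, ρ (x - y) • g y)).toLinearMap := by
    refine (EuclideanSpace.basisFun (Fin N) ℝ).toBasis.ext fun i => ?_
    have h2 : (∫ y in Ω, ρ (x - y) • g y) i = ∫ y in Ω, g y i * ρ (x - y) := by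
      refine ((EuclideanSpace.proj i : EuclideanSpace ℝ (Fin N) →L[ℝ] ℝ).integral_comp_comm
        hηg).symm.trans ?_
      simp [mul_comm]
    simp [hfd, hug.integral_eq _ hη hηc hx i, EuclideanSpace.inner_single_right, h2]
  ext v
  exact congrArg (fun l => l v) hL

theorem HasWeakGradient.enorm_fderiv_convolution_sq_le (hug : HasWeakGradient Ω u g)
    (hΩ : MeasurableSet Ω) (hu : IntegrableOn u Ω) (hg : IntegrableOn g Ω)
    (ρ : ContDiffBump (0 : EuclideanSpace ℝ (Fin N))) {x : EuclideanSpace ℝ (Fin N)}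
    (hx : closedBall x ρ.rOut ⊆ Ω) :
    ‖fderiv ℝ (ρ.normed volume ⋆[ContinuousLinearMap.lsmul ℝ ℝ, volume] Ω.indicator u) x‖ₑ ^ 2 ≤
      ∫⁻ y in Ω, ENNReal.ofReal (ρ.normed volume (x - y)) * ‖g y‖ₑ ^ 2 := by
  have hsupp : tsupport (fun y => ρ.normed volume (x - y)) ⊆ Ω := by
    refine subset_trans (closure_minimal (fun y hy => ?_) isClosed_closedBall) hx
    have : x - y ∈ Function.support (ρ.normed volume) := hy
    rw [ρ.support_normed_eq, mem_ball_zero_iff] at this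
    rw [mem_closedBall, dist_comm, dist_eq_norm]
    exact this.le
  rw [hug.fderiv_convolution hΩ hu hg ρ.contDiff_normed ρ.hasCompactSupport_normed hsupp]
  have hm : Measurable fun y => ENNReal.ofReal (ρ.normed volume (x - y)) :=
    (ρ.continuous_normed.comp (continuous_const.sub continuous_id)).measurable.ennreal_ofReal
  have hgm : AEMeasurable (fun y => ‖g y‖ₑ) (volume.restrict Ω) := hg.aestronglyMeasurable.enorm
  have hgm' : AEMeasurable (fun y => ‖g y‖ₑ)
      ((volume.restrict Ω).withDensity fun y => ENNReal.ofReal (ρ.normed volume (x - y))) :=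
    hgm.mono_ac (withDensity_absolutelyContinuous _ _)
  have hmass : ((volume.restrict Ω).withDensity
      fun y => ENNReal.ofReal (ρ.normed volume (x - y))) univ ≤ 1 := by
    rw [withDensity_apply _ MeasurableSet.univ, Measure.restrict_univ]
    refine (setLIntegral_le_lintegral _ _).trans ?_
    rw [lintegral_sub_left_eq_self (fun y => ENNReal.ofReal (ρ.normed volume y)) x,
      ← ofReal_integral_eq_lintegral_ofReal ρ.integrable_normed (ae_of_all _ ρ.nonneg_normed),
      ρ.integral_normed]
    simp
  have h1 := sq_lintegral_le_of_measure_univ_le_one hmass hgm'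
  rw [lintegral_withDensity_eq_lintegral_mul₀ hm.aemeasurable hgm,
    lintegral_withDensity_eq_lintegral_mul₀ hm.aemeasurable (hgm.pow_const 2)] at h1
  refine le_trans ?_ h1
  gcongr
  have h2 : ‖innerSL ℝ (∫ y in Ω, ρ.normed volume (x - y) • g y)‖ₑ =
      ‖∫ y in Ω, ρ.normed volume (x - y) • g y‖ₑ := by
    simp [enorm_eq_nnnorm, ← NNReal.coe_inj]
  rw [h2]
  refine (enorm_integral_le_lintegral_enorm _).trans (lintegral_mono fun y => ?_)
  simp [enorm_smul, Real.enorm_of_nonneg (ρ.nonneg_normed _)]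

end Mollify

variable {N : ℕ} {Ω : Set (EuclideanSpace ℝ (Fin N))} {u : EuclideanSpace ℝ (Fin N) → ℝ}
  {g : EuclideanSpace ℝ (Fin N) → EuclideanSpace ℝ (Fin N)}

theorem lintegral_mollify {h : EuclideanSpace ℝ (Fin N) → ℝ≥0∞} (hh : Measurable h)
    (Ω : Set (EuclideanSpace ℝ (Fin N))) (ρ : ContDiffBump (0 : EuclideanSpace ℝ (Fin N))) :
    Measurable (fun x => ∫⁻ y in Ω, ENNReal.ofReal (ρ.normed volume (x - y)) * h y) ∧
    ∫⁻ x, ∫⁻ y in Ω, ENNReal.ofReal (ρ.normed volume (x - y)) * h y = ∫⁻ y in Ω, h y := by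
  have hρ := (ρ.continuous_normed (μ := volume)).measurable
  have hm : Measurable fun q : EuclideanSpace ℝ (Fin N) × EuclideanSpace ℝ (Fin N) =>
      ENNReal.ofReal (ρ.normed volume (q.1 - q.2)) * h q.2 :=
    (hρ.comp (measurable_fst.sub measurable_snd)).ennreal_ofReal.mul (hh.comp measurable_snd)
  refine ⟨hm.lintegral_prod_right', ?_⟩
  rw [lintegral_lintegral_swap hm.aemeasurable]
  refine lintegral_congr fun y => ?_
  have hmy : Measurable fun x => ENNReal.ofReal (ρ.normed volume (x - y)) :=
    (hρ.comp (measurable_id.sub_const y)).ennreal_ofReal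
  rw [lintegral_mul_const _ hmy,
    lintegral_sub_right_eq_self (fun x => ENNReal.ofReal (ρ.normed volume x)) y,
    ← ofReal_integral_eq_lintegral_ofReal ρ.integrable_normed (ae_of_all _ ρ.nonneg_normed),
    ρ.integral_normed]
  simp

theorem exists_contDiffBump_seq (N : ℕ) :
    ∃ ρ : ℕ → ContDiffBump (0 : EuclideanSpace ℝ (Fin N)),
      Tendsto (fun n => (ρ n).rOut) atTop (𝓝 0) ∧ ∀ n, (ρ n).rOut ≤ 2 * (ρ n).rIn := by
  refine ⟨fun n => ⟨1 / ((n : ℝ) + 1), 2 * (1 / ((n : ℝ) + 1)), by positivity, ?_⟩, ?_, ?_⟩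
  · have : 0 < 1 / ((n : ℝ) + 1) := by positivity
    linarith
  · simpa using tendsto_one_div_add_atTop_nhds_zero_nat.const_mul (2 : ℝ)
  · intro n
    exact le_rfl

/-- A Poincaré inequality for a pair of subsets of `Ω` that see each other in `Ω`. -/
theorem HasWeakGradient.lintegral_enorm_sub_sq_le (hug : HasWeakGradient Ω u g) (hΩ : IsOpen Ω)
    (hu : IntegrableOn u Ω) (hg : IntegrableOn g Ω) {A B : Set (EuclideanSpace ℝ (Fin N))}
    (hA : MeasurableSet A) (hB : MeasurableSet B) (hAΩ : A ⊆ Ω) (hBΩ : B ⊆ Ω)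
    (hAB : ∀ a ∈ A, ∀ b ∈ B, segment ℝ a b ⊆ Ω) :
    ∫⁻ p, ‖u p.1 - u p.2‖ₑ ^ 2 ∂((volume.restrict A).prod (volume.restrict B)) ≤
      ediam Ω ^ 2 * ((volume A + volume B) * (2 ^ N * ∫⁻ x in Ω, ‖g x‖ₑ ^ 2)) := by
  obtain ⟨ρ, hρ0, hρ2⟩ := exists_contDiffBump_seq N
  have hui : Integrable (Ω.indicator u) := (integrable_indicator_iff hΩ.measurableSet).2 hu
  set g' := hg.aestronglyMeasurable.mk g with hg'
  have hgg' : g =ᵐ[volume.restrict Ω] g' := hg.aestronglyMeasurable.ae_eq_mk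
  have hgm : Measurable fun y => ‖g' y‖ₑ ^ 2 :=
    (hg.aestronglyMeasurable.stronglyMeasurable_mk.measurable.enorm).pow_const 2
  set v : ℕ → EuclideanSpace ℝ (Fin N) → ℝ := fun n =>
    (ρ n).normed volume ⋆[ContinuousLinearMap.lsmul ℝ ℝ, volume] Ω.indicator u with hv
  set G : ℕ → EuclideanSpace ℝ (Fin N) → ℝ≥0∞ := fun n x =>
    ∫⁻ y in Ω, ENNReal.ofReal ((ρ n).normed volume (x - y)) * ‖g' y‖ₑ ^ 2 with hG
  have hGm : ∀ n, Measurable (G n) := fun n => (lintegral_mollify hgm Ω (ρ n)).1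
  have hGi : ∀ n, ∫⁻ x, G n x = ∫⁻ x in Ω, ‖g x‖ₑ ^ 2 := by
    intro n
    rw [(lintegral_mollify hgm Ω (ρ n)).2]
    refine lintegral_congr_ae ?_
    filter_upwards [hgg'] with y hy
    rw [hy]
  have hvG : ∀ n x, closedBall x (ρ n).rOut ⊆ Ω → ‖fderiv ℝ (v n) x‖ₑ ^ 2 ≤ G n x := by
    intro n x hx
    refine (hug.enorm_fderiv_convolution_sq_le hΩ.measurableSet hu hg (ρ n) hx).trans_eq ?_
    refine lintegral_congr_ae ?_
    filter_upwards [hgg'] with y hy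
    rw [hy]
  have hvc : ∀ n, ContDiff ℝ 1 (v n) := fun n =>
    (ρ n).hasCompactSupport_normed.contDiff_convolution_left (n := 1) _ (ρ n).contDiff_normed
      hui.locallyIntegrable
  set F : ℕ → EuclideanSpace ℝ (Fin N) × EuclideanSpace ℝ (Fin N) → ℝ≥0∞ := fun n p =>
    ediam Ω ^ 2 * ∫⁻ t in Icc (0 : ℝ) 1, G n (p.1 + t • (p.2 - p.1)) with hF
  have hFm0 : ∀ n, Measurable fun p : EuclideanSpace ℝ (Fin N) × EuclideanSpace ℝ (Fin N) =>
      ∫⁻ t in Icc (0 : ℝ) 1, G n (p.1 + t • (p.2 - p.1)) := by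
    intro n
    have hm : Measurable fun q : (EuclideanSpace ℝ (Fin N) × EuclideanSpace ℝ (Fin N)) × ℝ =>
        G n (q.1.1 + q.2 • (q.1.2 - q.1.1)) := (hGm n).comp (by fun_prop)
    exact hm.lintegral_prod_right'
  have hFm : ∀ n, Measurable (F n) := fun n => (hFm0 n).const_mul _
  have hvF : ∀ a ∈ A, ∀ b ∈ B, ∀ᶠ n in atTop, ‖v n a - v n b‖ₑ ^ 2 ≤ F n (a, b) := by
    intro a ha b hb
    have hK : IsCompact (segment ℝ a b) := by
      rw [segment_eq_image_lineMap]
      exact isCompact_Icc.image AffineMap.lineMap_continuous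
    obtain ⟨δ, hδ, hsub⟩ := hK.exists_cthickening_subset_open hΩ (hAB a ha b hb)
    filter_upwards [hρ0.eventually (eventually_le_nhds hδ)] with n hn
    refine (enorm_sub_sq_le_lintegral_fderiv (hvc n) a b).trans ?_
    have hd : ‖b - a‖ₑ ≤ ediam Ω := by
      rw [← edist_eq_enorm_sub]
      exact edist_le_ediam_of_mem (hBΩ hb) (hAΩ ha)
    refine mul_le_mul' (by gcongr) (setLIntegral_mono' measurableSet_Icc fun t ht => ?_)
    refine hvG n _ (subset_trans ?_ hsub)
    have hmem : a + t • (b - a) ∈ segment ℝ a b := by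
      rw [segment_eq_image']
      exact ⟨t, ht, rfl⟩
    exact (closedBall_subset_closedBall hn).trans (closedBall_subset_cthickening hmem δ)
  have hconv : ∀ᵐ x ∂(volume : Measure (EuclideanSpace ℝ (Fin N))),
      Tendsto (fun n => v n x) atTop (𝓝 (Ω.indicator u x)) :=
    ContDiffBump.ae_convolution_tendsto_right_of_locallyIntegrable hρ0
      (Eventually.of_forall hρ2) hui.locallyIntegrable
  have hlim : ∀ᵐ p ∂((volume.restrict A).prod (volume.restrict B)),
      ‖u p.1 - u p.2‖ₑ ^ 2 ≤ liminf (fun n => F n p) atTop := by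
    have h1 : ∀ᵐ p ∂((volume.restrict A).prod (volume.restrict B)), p.1 ∈ A ∧
        Tendsto (fun n => v n p.1) atTop (𝓝 (Ω.indicator u p.1)) :=
      Measure.quasiMeasurePreserving_fst.ae
        ((ae_restrict_mem hA).and (ae_restrict_of_ae hconv))
    have h2 : ∀ᵐ p ∂((volume.restrict A).prod (volume.restrict B)), p.2 ∈ B ∧
        Tendsto (fun n => v n p.2) atTop (𝓝 (Ω.indicator u p.2)) :=
      Measure.quasiMeasurePreserving_snd.ae
        ((ae_restrict_mem hB).and (ae_restrict_of_ae hconv))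
    filter_upwards [h1, h2] with p hp1 hp2
    have ht : Tendsto (fun n => ‖v n p.1 - v n p.2‖ₑ ^ 2) atTop (𝓝 (‖u p.1 - u p.2‖ₑ ^ 2)) := by
      have h3 := hp1.2.sub hp2.2
      rw [indicator_of_mem (hAΩ hp1.1), indicator_of_mem (hBΩ hp2.1)] at h3
      exact ((ENNReal.continuous_pow 2).tendsto _).comp h3.enorm
    rw [← ht.liminf_eq]
    exact liminf_le_liminf (hvF p.1 hp1.1 p.2 hp2.1)
  have hFi : ∀ n, ∫⁻ p, F n p ∂((volume.restrict A).prod (volume.restrict B)) ≤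
      ediam Ω ^ 2 * ((volume A + volume B) * (2 ^ N * ∫⁻ x in Ω, ‖g x‖ₑ ^ 2)) := by
    intro n
    rw [lintegral_const_mul _ (hFm0 n)]
    gcongr
    have := lintegral_prod_segment_le volume (hGm n) A B
    rwa [hGi n, finrank_euclideanSpace_fin] at this
  calc _ ≤ ∫⁻ p, liminf (fun n => F n p) atTop ∂((volume.restrict A).prod (volume.restrict B)) :=
        lintegral_mono_ae hlim
    _ ≤ liminf (fun n => ∫⁻ p, F n p ∂((volume.restrict A).prod (volume.restrict B))) atTop :=
        lintegral_liminf_le hFm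
    _ ≤ _ := (liminf_le_liminf (Eventually.of_forall hFi)).trans (liminf_const _).le

/-- The integral of `u²` over `A` is controlled by `∫_Ω |∇u|² + ∫_Ω f u²`, uniformly in
`u ∈ H¹(Ω)`. -/
def ControlledOn (Ω : Set (EuclideanSpace ℝ (Fin N))) (f : EuclideanSpace ℝ (Fin N) → ℝ)
    (A : Set (EuclideanSpace ℝ (Fin N))) : Prop :=
  ∃ C : ℝ≥0, ∀ (u : EuclideanSpace ℝ (Fin N) → ℝ)
    (g : EuclideanSpace ℝ (Fin N) → EuclideanSpace ℝ (Fin N)),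
    MemLp u 2 (volume.restrict Ω) → HasWeakGradient Ω u g → MemLp g 2 (volume.restrict Ω) →
      ∫⁻ x in A, ‖u x‖ₑ ^ 2 ≤
        C * ((∫⁻ x in Ω, ‖g x‖ₑ ^ 2) + ∫⁻ x in Ω, ENNReal.ofReal (f x * u x ^ 2))

namespace ControlledOn

variable {f : EuclideanSpace ℝ (Fin N) → ℝ} {A B : Set (EuclideanSpace ℝ (Fin N))}

theorem mono (hB : ControlledOn Ω f B) (hAB : A ⊆ B) : ControlledOn Ω f A := by
  obtain ⟨C, hC⟩ := hB
  exact ⟨C, fun u g hu hug hg => (lintegral_mono_set hAB).trans (hC u g hu hug hg)⟩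

theorem empty : ControlledOn Ω f ∅ := ⟨0, by simp⟩

theorem union (hA : ControlledOn Ω f A) (hB : ControlledOn Ω f B) :
    ControlledOn Ω f (A ∪ B) := by
  obtain ⟨C, hC⟩ := hA
  obtain ⟨D, hD⟩ := hB
  refine ⟨C + D, fun u g hu hug hg => (lintegral_union_le _ _ _).trans ?_⟩
  rw [ENNReal.coe_add, add_mul]
  exact add_le_add (hC u g hu hug hg) (hD u g hu hug hg)

theorem of_segment_subset (hB : ControlledOn Ω f B) (hΩ : IsOpen Ω)
    (hΩb : Bornology.IsBounded Ω) (hAm : MeasurableSet A) (hBm : MeasurableSet B) (hAΩ : A ⊆ Ω)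
    (hBΩ : B ⊆ Ω) (hB0 : volume B ≠ 0) (hAB : ∀ a ∈ A, ∀ b ∈ B, segment ℝ a b ⊆ Ω) :
    ControlledOn Ω f A := by
  obtain ⟨C, hC⟩ := hB
  have hΩt : volume Ω ≠ ⊤ := hΩb.measure_lt_top.ne
  have hAt : volume A ≠ ⊤ := measure_ne_top_of_subset hAΩ hΩt
  have hBt : volume B ≠ ⊤ := measure_ne_top_of_subset hBΩ hΩt
  have : IsFiniteMeasure (volume.restrict Ω) := ⟨by simpa using hΩt.lt_top⟩
  set K : ℝ≥0∞ := ediam Ω ^ 2 * ((volume A + volume B) * 2 ^ N) with hK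
  have hKt : K ≠ ⊤ := by
    have : ediam Ω ≠ ⊤ := hΩb.ediam_ne_top
    finiteness
  set M : ℝ≥0∞ := (2 * (K + volume A * C)) / volume B with hM
  have hMt : M ≠ ⊤ := ENNReal.div_ne_top (by finiteness) hB0
  refine ⟨M.toNNReal, fun u g hu hug hg => ?_⟩
  rw [ENNReal.coe_toNNReal hMt]
  set X := ∫⁻ x in Ω, ‖g x‖ₑ ^ 2
  set Y := ∫⁻ x in Ω, ENNReal.ofReal (f x * u x ^ 2)
  have hP := hug.lintegral_enorm_sub_sq_le hΩ (hu.integrable (by norm_num))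
    (hg.integrable (by norm_num)) hAm hBm hAΩ hBΩ hAB
  have huA : AEMeasurable (fun x => ‖u x‖ₑ ^ 2) (volume.restrict A) :=
    (hu.1.mono_measure (Measure.restrict_mono hAΩ le_rfl)).enorm.pow_const 2
  have huB : AEMeasurable (fun x => ‖u x‖ₑ ^ 2) (volume.restrict B) :=
    (hu.1.mono_measure (Measure.restrict_mono hBΩ le_rfl)).enorm.pow_const 2
  have h1 : ∫⁻ p, ‖u p.1‖ₑ ^ 2 ∂((volume.restrict A).prod (volume.restrict B)) =
      volume B * ∫⁻ x in A, ‖u x‖ₑ ^ 2 := by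
    rw [lintegral_prod _ huA.comp_fst]
    simp [lintegral_mul_const'' _ huA, mul_comm]
  have h2 : ∫⁻ p, ‖u p.2‖ₑ ^ 2 ∂((volume.restrict A).prod (volume.restrict B)) =
      volume A * ∫⁻ x in B, ‖u x‖ₑ ^ 2 := by
    rw [lintegral_prod _ huB.comp_snd]
    simp [mul_comm]
  have h3 : volume B * ∫⁻ x in A, ‖u x‖ₑ ^ 2 ≤ (2 * (K + volume A * C)) * (X + Y) := by
    calc volume B * ∫⁻ x in A, ‖u x‖ₑ ^ 2
        ≤ ∫⁻ p, 2 * (‖u p.1 - u p.2‖ₑ ^ 2 + ‖u p.2‖ₑ ^ 2)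
            ∂((volume.restrict A).prod (volume.restrict B)) := by
          rw [← h1]
          refine lintegral_mono fun p => ?_
          have h4 : ‖u p.1‖ₑ ≤ ‖u p.1 - u p.2‖ₑ + ‖u p.2‖ₑ := by
            simpa using enorm_add_le (u p.1 - u p.2) (u p.2)
          have h5 := ENNReal.rpow_add_le_mul_rpow_add_rpow ‖u p.1 - u p.2‖ₑ ‖u p.2‖ₑ
            (one_le_two (α := ℝ))
          norm_num [ENNReal.rpow_two] at h5
          exact (pow_le_pow_left' h4 2).trans h5
      _ = 2 * ((∫⁻ p, ‖u p.1 - u p.2‖ₑ ^ 2 ∂((volume.restrict A).prod (volume.restrict B))) +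
            volume A * ∫⁻ x in B, ‖u x‖ₑ ^ 2) := by
          rw [lintegral_const_mul' _ _ (by simp), lintegral_add_right' _ huB.comp_snd, h2]
      _ ≤ 2 * (K * (X + Y) + volume A * (C * (X + Y))) := by
          gcongr
          · refine hP.trans ?_
            rw [hK, mul_assoc (ediam Ω ^ 2), mul_assoc (volume A + volume B)]
            gcongr
            exact le_self_add
          · exact hC u g hu hug hg
      _ = _ := by ring
  rwa [hM, div_eq_mul_inv, mul_right_comm, ← div_eq_mul_inv,
    ENNReal.le_div_iff_mul_le (Or.inl hB0) (Or.inl hBt), mul_comm]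

theorem exists_of_pos (hΩ : IsOpen Ω) (hΩ0 : Ω.Nonempty) (hf : IntegrableOn f Ω)
    (hfpos : ∀ᵐ x ∂(volume.restrict Ω), 0 < f x) :
    ∃ B ⊆ Ω, MeasurableSet B ∧ volume B ≠ 0 ∧ ControlledOn Ω f B := by
  set f' := hf.aestronglyMeasurable.mk f with hf'
  have hff' : f =ᵐ[volume.restrict Ω] f' := hf.aestronglyMeasurable.ae_eq_mk
  have hfm : Measurable f' := hf.aestronglyMeasurable.stronglyMeasurable_mk.measurable
  set B : ℕ → Set (EuclideanSpace ℝ (Fin N)) := fun n => Ω ∩ {x | 1 / ((n : ℝ) + 1) < f' x}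
  have hBm : ∀ n, MeasurableSet (B n) := fun n =>
    hΩ.measurableSet.inter (measurableSet_lt measurable_const hfm)
  have hex : ∃ n, volume (B n) ≠ 0 := by
    by_contra! h
    have h0 : volume (⋃ n, B n) = 0 := measure_iUnion_null h
    refine (hΩ.measure_pos volume hΩ0).ne' (le_antisymm ?_ zero_le)
    rw [← h0]
    refine measure_mono_ae ?_
    have := (ae_restrict_iff' hΩ.measurableSet).1 (hfpos.and hff')
    filter_upwards [this] with x hx hxΩ
    obtain ⟨hpos, heq⟩ := hx hxΩ
    rw [heq] at hpos
    obtain ⟨n, hn⟩ := exists_nat_one_div_lt hpos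
    exact mem_iUnion.2 ⟨n, hxΩ, hn⟩
  obtain ⟨n, hn⟩ := hex
  refine ⟨B n, inter_subset_left, hBm n, hn, n + 1, fun u g hu hug hg => ?_⟩
  calc ∫⁻ x in B n, ‖u x‖ₑ ^ 2
      ≤ ∫⁻ x in B n, (n + 1) * ENNReal.ofReal (f x * u x ^ 2) := by
        refine lintegral_mono_ae ?_
        filter_upwards [ae_restrict_mem (hBm n),
          ae_restrict_of_ae_restrict_of_subset inter_subset_left hff'] with x hx hxf
        have hlt : 1 / ((n : ℝ) + 1) < f x := hxf ▸ hx.2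
        rw [div_lt_iff₀ (by positivity)] at hlt
        have e : ((n : ℝ≥0∞) + 1) = ENNReal.ofReal ((n : ℝ) + 1) := by
          rw [ENNReal.ofReal_add (by positivity) zero_le_one]
          simp
        rw [e, ← ENNReal.ofReal_mul (by positivity), Real.enorm_eq_ofReal_abs,
          ← ENNReal.ofReal_pow (abs_nonneg _), sq_abs]
        apply ENNReal.ofReal_le_ofReal
        nlinarith [sq_nonneg (u x)]
    _ = (n + 1) * ∫⁻ x in B n, ENNReal.ofReal (f x * u x ^ 2) :=
        lintegral_const_mul' _ _ (by finiteness)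
    _ ≤ _ := by
        push_cast
        exact mul_le_mul' le_rfl ((lintegral_mono_set inter_subset_left).trans le_add_self)

/-- In a connected open set, control spreads from one set of positive measure to small balls
around all points. -/
theorem exists_ball (hΩ : IsOpen Ω) (hΩb : Bornology.IsBounded Ω) (hΩc : IsPreconnected Ω)
    (hBΩ : B ⊆ Ω) (hBm : MeasurableSet B) (hB0 : volume B ≠ 0) (hB : ControlledOn Ω f B)
    {x : EuclideanSpace ℝ (Fin N)} (hx : x ∈ Ω) :
    ∃ r > 0, ball x r ⊆ Ω ∧ ControlledOn Ω f (ball x r) := by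
  set S : Set (EuclideanSpace ℝ (Fin N)) := {x | ∃ r > 0, ball x r ⊆ Ω ∧ ControlledOn Ω f (ball x r)}
  have hspread : ∀ (y : EuclideanSpace ℝ (Fin N)) (r : ℝ) (D : Set (EuclideanSpace ℝ (Fin N))),
      ball y r ⊆ Ω → D ⊆ ball y r → MeasurableSet D → volume D ≠ 0 → ControlledOn Ω f D →
      ControlledOn Ω f (ball y r) := fun y r D hy hD hDm hD0 hDc =>
    hDc.of_segment_subset hΩ hΩb measurableSet_ball hDm hy (hD.trans hy) hD0 fun a ha b hb =>
      ((convex_ball y r).segment_subset ha (hD hb)).trans hy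
  have hSo : IsOpen S := by
    rw [Metric.isOpen_iff]
    rintro y ⟨r, hr, hyΩ, hyc⟩
    refine ⟨r / 2, by positivity, fun z hz => ⟨r / 2, by positivity, ?_⟩⟩
    have : ball z (r / 2) ⊆ ball y r := by
      refine ball_subset_ball' ?_
      rw [mem_ball] at hz
      linarith
    exact ⟨this.trans hyΩ, hyc.mono this⟩
  refine hΩc.subset_of_closure_inter_subset hSo ?_ ?_ hx
  · obtain ⟨y, hy, hyB⟩ := exists_mem_forall_mem_nhdsWithin_pos_measure hB0
    obtain ⟨r, hr, hyr⟩ := Metric.isOpen_iff.1 hΩ y (hBΩ hy)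
    refine ⟨y, hBΩ hy, r, hr, hyr, hspread y r (B ∩ ball y r) hyr inter_subset_right
      (hBm.inter measurableSet_ball) ?_ (hB.mono inter_subset_left)⟩
    exact (hyB _ (inter_mem_nhdsWithin B (ball_mem_nhds y hr))).ne'
  · rintro y ⟨hyS, hy⟩
    obtain ⟨r, hr, hyr⟩ := Metric.isOpen_iff.1 hΩ y hy
    obtain ⟨z, ⟨s, hs, -, hzc⟩, hyz⟩ := Metric.mem_closure_iff.1 hyS r hr
    have hzr : z ∈ ball y r := by rwa [mem_ball, dist_comm]
    refine ⟨r, hr, hyr, hspread y r (ball z s ∩ ball y r) hyr inter_subset_right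
      (measurableSet_ball.inter measurableSet_ball) ?_ (hzc.mono inter_subset_left)⟩
    exact ((isOpen_ball.inter isOpen_ball).measure_pos volume
      ⟨z, mem_ball_self hs, hzr⟩).ne'

end ControlledOn

/-- Near a boundary point, a Lipschitz open set is visible from a ball inside. -/
theorem IsLipschitzOpen.exists_ball_segment_subset (hΩ : IsLipschitzOpen Ω)
    {p : EuclideanSpace ℝ (Fin N)} (hp : p ∈ frontier Ω) :
    ∃ δ > 0, ∃ c ∈ Ω, ∀ a ∈ Ω ∩ ball p δ, ∀ b ∈ ball c δ, segment ℝ a b ⊆ Ω := by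
  obtain ⟨r, hr, ν, hν, L, φ, hφ, hmem⟩ := hΩ.2 p hp
  set P := (Submodule.span ℝ {ν})ᗮ.orthogonalProjectionOnto with hP
  set δ : ℝ := r / (4 * (L + 1)) with hδ
  have hL : (0 : ℝ) < L + 1 := by positivity
  have hδ0 : 0 < δ := by positivity
  have hLδ : 4 * (L + 1) * δ = r := by rw [hδ]; field_simp
  have hδr : 4 * δ ≤ r := by nlinarith [L.coe_nonneg]
  set c := p + (2 * (L + 1) * δ) • ν with hc
  have hPν : P ν = 0 := by
    rw [hP, Submodule.orthogonalProjectionOnto_eq_zero_iff, Submodule.orthogonal_orthogonal]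
    exact Submodule.mem_span_singleton_self ν
  have hseg : ∀ a ∈ Ω ∩ ball p δ, ∀ b ∈ ball c δ, segment ℝ a b ⊆ Ω := by
    rintro a ⟨haΩ, hap⟩ b hb w hw
    have har : a ∈ ball p r := ball_subset_ball (by linarith) hap
    have hcp : dist c p = r / 2 := by
      rw [hc, dist_eq_norm, add_sub_cancel_left, norm_smul, hν, mul_one, Real.norm_of_nonneg
        (by positivity)]
      linarith
    have hbr : b ∈ ball p r := by
      rw [mem_ball] at hb ⊢
      linarith [dist_triangle b c p]
    have hwr : w ∈ ball p r := (convex_ball p r).segment_subset har hbr hw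
    rw [hmem w hwr]
    have ha := (hmem a har).1 haΩ
    rw [segment_eq_image'] at hw
    obtain ⟨t, ⟨ht0, ht1⟩, rfl⟩ := hw
    have hdec : b - a = (2 * (L + 1) * δ) • ν + ((b - c) - (a - p)) := by rw [hc]; abel
    have hsm : ‖(b - c) - (a - p)‖ ≤ 2 * δ := by
      rw [mem_ball, dist_eq_norm] at hb hap
      linarith [norm_sub_le (b - c) (a - p)]
    have h1 : ‖P (b - a)‖ ≤ 2 * δ := by
      rw [hdec, map_add, map_smul, hPν, smul_zero, zero_add]
      exact (Submodule.norm_orthogonalProjectionOnto_apply_le _ _).trans hsm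
    have h2 : 2 * L * δ ≤ inner ℝ ν (b - a) := by
      have h3 := abs_real_inner_le_norm ν ((b - c) - (a - p))
      rw [hν, one_mul] at h3
      have h4 := (abs_le.1 (h3.trans hsm)).1
      rw [hdec, inner_add_right, inner_smul_right, real_inner_self_eq_norm_sq, hν]
      linarith
    have h5 : φ (P (a + t • (b - a))) ≤ φ (P a) + L * (t * (2 * δ)) := by
      have h6 := hφ.dist_le_mul (P (a + t • (b - a))) (P a)
      rw [dist_eq_norm, dist_eq_norm, map_add, add_sub_cancel_left, map_smul, norm_smul,
        Real.norm_of_nonneg ht0] at h6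
      have h7 : (L : ℝ) * (t * ‖P (b - a)‖) ≤ L * (t * (2 * δ)) := by gcongr
      rw [map_add, map_smul]
      linarith [le_abs_self (φ (P a + t • P (b - a)) - φ (P a)),
        Real.norm_eq_abs (φ (P a + t • P (b - a)) - φ (P a))]
    rw [inner_add_right, inner_smul_right]
    nlinarith
  refine ⟨δ, hδ0, c, ?_, hseg⟩
  obtain ⟨a, ha, hpa⟩ := Metric.mem_closure_iff.1 (frontier_subset_closure hp) δ hδ0
  exact hseg a ⟨ha, by rwa [mem_ball, dist_comm]⟩ c (mem_ball_self hδ0) (right_mem_segment ℝ a c)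

theorem IsLipschitzOpen.controlledOn {f : EuclideanSpace ℝ (Fin N) → ℝ} (hΩ : IsLipschitzOpen Ω)
    (hΩb : Bornology.IsBounded Ω) (hΩc : IsConnected Ω) (hf : IntegrableOn f Ω)
    (hfpos : ∀ᵐ x ∂(volume.restrict Ω), 0 < f x) : ControlledOn Ω f Ω := by
  obtain ⟨B, hBΩ, hBm, hB0, hB⟩ := ControlledOn.exists_of_pos hΩ.1 hΩc.nonempty hf hfpos
  have hball : ∀ x ∈ Ω, ∃ r > 0, ball x r ⊆ Ω ∧ ControlledOn Ω f (ball x r) := fun x hx =>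
    ControlledOn.exists_ball hΩ.1 hΩb hΩc.isPreconnected hBΩ hBm hB0 hB hx
  have key : ControlledOn Ω f (Ω ∩ closure Ω) := by
    refine hΩb.isCompact_closure.induction_on (p := fun s => ControlledOn Ω f (Ω ∩ s)) ?_ ?_ ?_ ?_
    · simpa using ControlledOn.empty
    · exact fun s t hst ht => ht.mono (inter_subset_inter_right _ hst)
    · intro s t hs ht
      rw [inter_union_distrib_left]
      exact hs.union ht
    · intro x hx
      by_cases hxΩ : x ∈ Ω
      · obtain ⟨r, hr, -, hxc⟩ := hball x hxΩ
        exact ⟨ball x r, mem_nhdsWithin_of_mem_nhds (ball_mem_nhds x hr),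
          hxc.mono inter_subset_right⟩
      · have hxf : x ∈ frontier Ω := by
          rw [hΩ.1.frontier_eq]
          exact ⟨hx, hxΩ⟩
        obtain ⟨δ, hδ, c, hc, hseg⟩ := hΩ.exists_ball_segment_subset hxf
        obtain ⟨r, hr, hcΩ, hcc⟩ := hball c hc
        refine ⟨ball x δ, mem_nhdsWithin_of_mem_nhds (ball_mem_nhds x hδ), ?_⟩
        refine (hcc.mono (A := ball c (min r δ)) (ball_subset_ball (min_le_left _ _))).of_segment_subset
          hΩ.1 hΩb (hΩ.1.measurableSet.inter measurableSet_ball) measurableSet_ball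
          inter_subset_left ((ball_subset_ball (min_le_left _ _)).trans hcΩ)
          (measure_ball_pos volume c (lt_min hr hδ)).ne' fun a ha b hb =>
            hseg a ha b (ball_subset_ball (min_le_right _ _) hb)
  rwa [inter_eq_left.2 subset_closure] at key

end WeightedPoincare

theorem eLpNorm_two_sq {α F : Type*} [MeasurableSpace α] [NormedAddCommGroup F] {μ : Measure α}
    (w : α → F) : eLpNorm w 2 μ ^ 2 = ∫⁻ x, ‖w x‖ₑ ^ 2 ∂μ := by
  simpa using eLpNorm_nnreal_pow_eq_lintegral (f := w) (μ := μ) (p := 2) two_ne_zero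

theorem mainTheorem7 (N : ℕ) (hN : 1 ≤ N) (Ω : Set (EuclideanSpace ℝ (Fin N)))
    (hΩ_bdd : Bornology.IsBounded Ω) (hΩ_conn : IsConnected Ω) (hΩ_lip : IsLipschitzOpen Ω)
    (f : EuclideanSpace ℝ (Fin N) → ℝ) (hf : IntegrableOn f Ω volume)
    (hf_pos : ∀ᵐ x ∂(volume.restrict Ω), 0 < f x) :
    ∃ C : ℝ≥0, 0 < C ∧
      ∀ u : EuclideanSpace ℝ (Fin N) → ℝ, MemH1 Ω u →
        ∀ g : EuclideanSpace ℝ (Fin N) → EuclideanSpace ℝ (Fin N), HasWeakGradient Ω u g →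
          h1Norm Ω u g ≤
            (C : ℝ≥0∞) * (eLpNorm g 2 (volume.restrict Ω) + weightedL2Norm Ω f u) := by
  obtain ⟨C, hC⟩ := hΩ_lip.controlledOn hΩ_bdd hΩ_conn hf hf_pos
  refine ⟨NNReal.sqrt (C + 1), NNReal.sqrt_pos.2 (by positivity), fun u hu g hug => ?_⟩
  have hC0 : ((NNReal.sqrt (C + 1) : ℝ≥0) : ℝ≥0∞) ≠ 0 := by
    simp
  by_cases hgt : eLpNorm g 2 (volume.restrict Ω) = ⊤
  · rw [hgt, top_add, ENNReal.mul_top hC0]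
    exact le_top
  have hg : MemLp g 2 (volume.restrict Ω) :=
    ⟨hug.locallyIntegrableOn_grad.aestronglyMeasurable, lt_top_iff_ne_top.2 hgt⟩
  have h := hC u g hu.1 hug hg
  rw [← eLpNorm_two_sq, ← eLpNorm_two_sq] at h
  have hw : weightedL2Norm Ω f u ^ 2 = ∫⁻ x in Ω, ENNReal.ofReal (f x * u x ^ 2) := by
    rw [weightedL2Norm, ← ENNReal.rpow_two, ← ENNReal.rpow_mul]
    norm_num
  rw [← hw] at h
  set X := eLpNorm g 2 (volume.restrict Ω)
  set Y := weightedL2Norm Ω f u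
  have hsq : ((NNReal.sqrt (C + 1) : ℝ≥0) : ℝ≥0∞) ^ 2 = C + 1 := by
    exact_mod_cast NNReal.sq_sqrt (C + 1)
  have hXY : X ^ 2 + Y ^ 2 ≤ (X + Y) ^ 2 := by
    rw [add_sq, add_right_comm]
    exact le_self_add
  calc h1Norm Ω u g ≤ ((((NNReal.sqrt (C + 1) : ℝ≥0) : ℝ≥0∞) * (X + Y)) ^ 2) ^ (1 / 2 : ℝ) := by
        rw [h1Norm]
        gcongr
        rw [mul_pow, hsq]
        calc eLpNorm u 2 (volume.restrict Ω) ^ 2 + X ^ 2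
            ≤ C * (X ^ 2 + Y ^ 2) + (X ^ 2 + Y ^ 2) := add_le_add h le_self_add
          _ = (C + 1) * (X ^ 2 + Y ^ 2) := by ring
          _ ≤ _ := by gcongr
    _ = _ := by
        rw [← ENNReal.rpow_two, ← ENNReal.rpow_mul]
        norm_num
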